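/- For $a,q\in\mathbb C$ with $|q|<1$ write $(a;q)_\infty=\prod_{k\ge 0}(1-aq^k)$. Let $0<|q|<1$, choose $\tau\in\mathbb C$ with $q=e^{2\pi i\tau}$, and interpret every fractional power of $q$ as $q^r=e^{2\pi i r\tau}$. Define the septic theta functions \[ a(q)=-\sum_{n=-\infty}^{\infty}(-1)^n q^{(14n+5)^2/56},\qquad b(q)=\sum_{n=-\infty}^{\infty}(-1)^n q^{(14n+3)^2/56},\qquad c(q)=\sum_{n=-\infty}^{\infty}(-1)^n q^{(14n+1)^2/56}, \] and the quotients \[ x=q^{7/8}(q^7;q^7)_\infty^3\,\frac{b(q)}{c(q)^2},\qquad y=-q^{7/8}(q^7;q^7)_\infty^3\,\frac{a(q)}{b(q)^2},\qquad z=q^{7/8}(q^7;q^7)_\infty^3\,\frac{c(q)}{a(q)^2}. \] Then $a(q)$, $b(q)$, $c(q)$, $(q;q)_\infty$, $(q^7;q^7)_\infty$, $y$ and $z$ are nonzero (so that all quotients here are well defined), and \begin{align*} \frac{(q;q)_\infty^4}{q\,(q^7;q^7)_\infty^4}&=\frac{z^2-xz-y^2-6yz}{yz},\\ q^2\,\frac{(q^7;q^7)_\infty^7}{(q;q)_\infty}&=xyz,\\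 q\,(q;q)_\infty^3(q^7;q^7)_\infty^3&=x\left(z^2-y^2+6xy-7xz\right),\\ \frac{(q;q)_\infty^7}{(q^7;q^7)_\infty}&=x^3-32x^2y+13xy^2-y^3+45x^2z-13xz^2+z^3. \end{align*} -/

import Mathlib

open Complex Filter Topology

namespace Septic

noncomputable section

/-- The nome `q = exp (2 π i τ)`. -/
def nome (τ : ℂ) : ℂ := cexp (2 * Real.pi * I * τ)

/-- The fractional power `q ^ r = exp (2 π i r τ)` of the nome `q = exp (2 π i τ)`; choosing `τ`
amounts to choosing a logarithm of `q`, used for all fractional powers simultaneously. -/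
def qPow (τ : ℂ) (r : ℚ) : ℂ := cexp (2 * Real.pi * I * (r : ℂ) * τ)

/-- `(a; q)_n = ∏_{k = 0}^{n - 1} (1 - a q ^ k)`. -/
def qPoch (a q : ℂ) (n : ℕ) : ℂ := ∏ k ∈ Finset.range n, (1 - a * q ^ k)

/-- `(a; q)_∞ = ∏_{k ≥ 0} (1 - a q ^ k)`. -/
def qPochInf (a q : ℂ) : ℂ := ∏' k : ℕ, (1 - a * q ^ k)

/-- For `|q| < 1` the infinite product converges, to the limit of the finite ones. -/
theorem tendsto_qPoch (a : ℂ) {q : ℂ} (hq : ‖q‖ < 1) :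
    Tendsto (qPoch a q) atTop (𝓝 (qPochInf a q)) := by
  have hm : Multipliable fun k : ℕ => 1 - a * q ^ k := by
    have h : Multipliable fun k : ℕ => 1 + -(a * q ^ k) := by
      apply multipliable_one_add_of_summable
      simpa using (summable_geometric_of_lt_one (norm_nonneg _) hq).mul_left ‖a‖
    simpa [sub_eq_add_neg] using h
  exact hm.hasProd.tendsto_prod_nat

/-- The bilateral theta series `∑_{n ∈ ℤ} (-1) ^ n q ^ ((14 n + k) ^ 2 / 56)`. -/
def thetaSeries (k : ℤ) (τ : ℂ) : ℂ :=
  ∑' n : ℤ, (-1 : ℂ) ^ n * qPow τ (((14 * n + k : ℤ) : ℚ) ^ 2 / 56)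

/-- The theta series converges (absolutely) on the upper half plane. -/
theorem summable_thetaSeries (k : ℤ) {τ : ℂ} (hτ : 0 < τ.im) :
    Summable fun n : ℤ => (-1 : ℂ) ^ n * qPow τ (((14 * n + k : ℤ) : ℚ) ^ 2 / 56) := by
  have h7 : 0 < (7 * τ).im := by simpa using hτ
  have hs := ((summable_jacobiTheta₂_term_iff ((k : ℂ) * τ / 2 + 1 / 2) (7 * τ)).2 h7).mul_left
    (cexp (2 * Real.pi * I * ((k : ℂ) ^ 2 / 56) * τ))
  refine hs.congr fun n => ?_
  have h1 : (-1 : ℂ) ^ n = cexp ((n : ℂ) * (Real.pi * I)) := by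
    rw [Complex.exp_int_mul, Complex.exp_pi_mul_I]
  rw [h1, jacobiTheta₂_term, qPow, ← Complex.exp_add, ← Complex.exp_add]
  congr 1
  push_cast
  ring

/-- `a(q) = - ∑ (-1) ^ n q ^ ((14 n + 5) ^ 2 / 56)`. -/
def thetaA (τ : ℂ) : ℂ := -thetaSeries 5 τ

/-- `b(q) = ∑ (-1) ^ n q ^ ((14 n + 3) ^ 2 / 56)`. -/
def thetaB (τ : ℂ) : ℂ := thetaSeries 3 τ

/-- `c(q) = ∑ (-1) ^ n q ^ ((14 n + 1) ^ 2 / 56)`. -/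
def thetaC (τ : ℂ) : ℂ := thetaSeries 1 τ

/-- `x(q) = q ^ (7 / 8) (q ^ 7; q ^ 7)_∞ ^ 3 b(q) / c(q) ^ 2`. -/
def x (τ : ℂ) : ℂ :=
  qPow τ (7 / 8) * qPochInf (nome τ ^ 7) (nome τ ^ 7) ^ 3 * (thetaB τ / thetaC τ ^ 2)

/-- `y(q) = - q ^ (7 / 8) (q ^ 7; q ^ 7)_∞ ^ 3 a(q) / b(q) ^ 2`. -/
def y (τ : ℂ) : ℂ :=
  -(qPow τ (7 / 8)) * qPochInf (nome τ ^ 7) (nome τ ^ 7) ^ 3 * (thetaA τ / thetaB τ ^ 2)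

/-- `z(q) = q ^ (7 / 8) (q ^ 7; q ^ 7)_∞ ^ 3 c(q) / a(q) ^ 2`. -/
def z (τ : ℂ) : ℂ :=
  qPow τ (7 / 8) * qPochInf (nome τ ^ 7) (nome τ ^ 7) ^ 3 * (thetaC τ / thetaA τ ^ 2)

end

end Septic

/-! Put `σ = 7τ` and `θ(u) = thetaChar (-1) σ (u + 1/2)`, an odd theta function. Then `a`, `-b`,
`-c` are its values at `u = 1/7, 2/7, 3/7`, i.e. at multiples of a point of order seven on the
elliptic curve of `σ`.

With `v(u) = (β, γ)` formed from the level `2σ` series at `u` and `u + 1/2`, the addition formula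
makes `θ(u + w) θ(u - w)` a 2×2 determinant of `v(u)` and `v(w)`. The Plücker relation for the
vectors at `0, 1/7, 2/7, 3/7` is the Klein quartic `a³b + b³c + c³a = 0`.

The squares of the three even theta functions are linear forms in `v(u)`. Squaring
`thetaChar_duplication` therefore gives the values of a binary cubic at the four vectors, and these
determine it. Its discriminant, computed once from the coefficients and once from the linear
factors, yields `(abc)⁴ / K⁴` as a rational function of `a, b, c`, where `2K` is the product of the
even theta constants (`septic_relations_of_brackets`).

By the Jacobi triple product, `abc` and `K = q^(7/8) (q⁷;q⁷)³` are Euler products, so this is the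
first identity. The second is the product `xyz` itself; the other two are products of earlier ones,
reduced by the conic `xy - xz + yz = 0`, which is the Klein quartic again (`septic_identities`). -/

namespace Septic

/-! ### Theta series with characteristics: addition and duplication. -/

/-- The general term `ε ^ n exp (π i σ (n + r) ^ 2)` of a theta series with characteristics. -/
noncomputable def thetaCharTerm (ε σ r : ℂ) (n : ℤ) : ℂ :=
  ε ^ n * cexp (Real.pi * I * σ * ((n : ℂ) + r) ^ 2)

/-- The theta series with characteristics `∑ ε ^ n exp (π i σ (n + r) ^ 2)`. -/
noncomputable def thetaChar (ε σ r : ℂ) : ℂ := ∑' n : ℤ, thetaCharTerm ε σ r n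

theorem norm_eq_one_of_mul_self {ε : ℂ} (hε : ε * ε = 1) : ‖ε‖ = 1 := by
  rcases mul_self_eq_one_iff.1 hε with rfl | rfl <;> simp

theorem summable_norm_thetaCharTerm {ε σ : ℂ} (hε : ε * ε = 1) (hσ : 0 < σ.im) (r : ℂ) :
    Summable fun n => ‖thetaCharTerm ε σ r n‖ := by
  have hs := (((summable_jacobiTheta₂_term_iff (σ * r) σ).2 hσ).norm).mul_left
    ‖cexp (Real.pi * I * σ * r ^ 2)‖
  refine hs.congr fun n => ?_
  rw [thetaCharTerm, norm_mul, norm_zpow, norm_eq_one_of_mul_self hε, one_zpow, one_mul,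
    ← norm_mul, jacobiTheta₂_term, ← Complex.exp_add]
  congr 2
  ring

theorem summable_thetaCharTerm {ε σ : ℂ} (hε : ε * ε = 1) (hσ : 0 < σ.im) (r : ℂ) :
    Summable (thetaCharTerm ε σ r) :=
  (summable_norm_thetaCharTerm hε hσ r).of_norm

theorem ne_zero_of_mul_self {ε : ℂ} (hε : ε * ε = 1) : ε ≠ 0 :=
  left_ne_zero_of_mul_eq_one hε

theorem zpow_neg_of_mul_self {ε : ℂ} (hε : ε * ε = 1) (n : ℤ) : ε ^ (-n) = ε ^ n := by
  rw [zpow_neg, ← inv_zpow, inv_eq_of_mul_eq_one_left hε]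

theorem zpow_two_mul_of_mul_self {ε : ℂ} (hε : ε * ε = 1) (n : ℤ) : ε ^ (2 * n) = 1 := by
  rw [zpow_mul, zpow_ofNat, pow_two, hε, one_zpow]

theorem thetaChar_neg {ε : ℂ} (hε : ε * ε = 1) (σ r : ℂ) :
    thetaChar ε σ (-r) = thetaChar ε σ r := by
  rw [thetaChar, ← (Equiv.neg ℤ).tsum_eq, thetaChar]
  refine tsum_congr fun n => ?_
  rw [thetaCharTerm, thetaCharTerm, Equiv.neg_apply, zpow_neg_of_mul_self hε]
  push_cast
  congr 2
  ring

theorem thetaChar_add_one {ε : ℂ} (hε : ε * ε = 1) (σ r : ℂ) :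
    thetaChar ε σ (r + 1) = ε * thetaChar ε σ r := by
  rw [thetaChar, ← (Equiv.subRight (1 : ℤ)).tsum_eq, thetaChar, ← tsum_mul_left]
  refine tsum_congr fun n => ?_
  rw [thetaCharTerm, thetaCharTerm, Equiv.subRight_apply, zpow_sub_one₀ (ne_zero_of_mul_self hε),
    inv_eq_of_mul_eq_one_left hε]
  push_cast
  rw [mul_comm (ε ^ n) ε, mul_assoc]
  congr 3
  ring

/-- Integers are even or odd. -/
def evenOddEquiv : ℤ ⊕ ℤ ≃ ℤ where
  toFun := Sum.elim (fun n => 2 * n) (fun n => 2 * n + 1)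
  invFun n := if n % 2 = 0 then Sum.inl (n / 2) else Sum.inr (n / 2)
  left_inv := by
    rintro (n | n)
    · simp
    · have h1 : (2 * n + 1) % 2 ≠ 0 := by omega
      have h2 : (2 * n + 1) / 2 = n := by omega
      simp [h2]
  right_inv n := by
    dsimp only
    split_ifs with h
    · simp only [Sum.elim_inl]; omega
    · simp only [Sum.elim_inr]; omega

/-- Pairs of integers `(m, n)` in terms of `m + n` and `m - n`, which have the same parity. -/
def sumDiffEquiv : (ℤ × ℤ) ⊕ (ℤ × ℤ) ≃ ℤ × ℤ where
  toFun := Sum.elim (fun p => (p.1 + p.2, p.1 - p.2)) (fun p => (p.1 + p.2 + 1, p.1 - p.2))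
  invFun p := if (p.1 + p.2) % 2 = 0 then Sum.inl ((p.1 + p.2) / 2, (p.1 - p.2) / 2)
    else Sum.inr ((p.1 + p.2) / 2, (p.1 - p.2) / 2)
  left_inv := by
    rintro (⟨m, n⟩ | ⟨m, n⟩)
    · have h : (m + n + (m - n)) % 2 = 0 := by omega
      simp only [Sum.elim_inl, h, if_true, Sum.inl.injEq, Prod.mk.injEq]
      omega
    · have h : ¬ (m + n + 1 + (m - n)) % 2 = 0 := by omega
      simp only [Sum.elim_inr, h, if_false, Sum.inr.injEq, Prod.mk.injEq]
      omega
  right_inv p := by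
    obtain ⟨m, n⟩ := p
    dsimp only
    split_ifs with h
    · simp only [Sum.elim_inl, Prod.mk.injEq]; omega
    · simp only [Sum.elim_inr, Prod.mk.injEq]; omega

theorem tsum_sum_equiv {α β γ : Type*} (e : α ⊕ β ≃ γ) {f : γ → ℂ} (hf : Summable f) :
    ∑' c, f c = ∑' a, f (e (Sum.inl a)) + ∑' b, f (e (Sum.inr b)) := by
  have h : Summable (f ∘ e) := e.summable_iff.2 hf
  have hl : Summable ((f ∘ e) ∘ Sum.inl) := h.comp_injective Sum.inl_injective
  have hr : Summable ((f ∘ e) ∘ Sum.inr) := h.comp_injective Sum.inr_injective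
  exact (e.hasSum_iff.1 (hl.hasSum.sum hr.hasSum)).tsum_eq

theorem im_ofNat_mul_pos {σ : ℂ} (hσ : 0 < σ.im) (n : ℕ) [n.AtLeastTwo] :
    0 < ((OfNat.ofNat n : ℂ) * σ).im := by
  have : (0 : ℝ) < OfNat.ofNat n := Nat.ofNat_pos
  simpa using hσ

/-- Splitting a theta series into its even and its odd part. -/
theorem thetaChar_eq_even_add_odd {ε σ : ℂ} (hε : ε * ε = 1) (hσ : 0 < σ.im) (r : ℂ) :
    thetaChar ε σ r = thetaChar 1 (4 * σ) (r / 2) + ε * thetaChar 1 (4 * σ) (r / 2 + 1 / 2) := by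
  rw [thetaChar, tsum_sum_equiv evenOddEquiv (summable_thetaCharTerm hε hσ r), thetaChar, thetaChar,
    ← tsum_mul_left]
  congr 1
  · refine tsum_congr fun n => ?_
    simp only [thetaCharTerm, evenOddEquiv, Equiv.coe_fn_mk, Sum.elim_inl,
      zpow_two_mul_of_mul_self hε, one_zpow]
    push_cast
    congr 2
    ring
  · refine tsum_congr fun n => ?_
    simp only [thetaCharTerm, evenOddEquiv, Equiv.coe_fn_mk, Sum.elim_inr,
      zpow_add_one₀ (ne_zero_of_mul_self hε), zpow_two_mul_of_mul_self hε, one_zpow, one_mul]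
    push_cast
    congr 2
    ring

/-- The addition formula for theta series with characteristics. -/
theorem thetaChar_add_mul_thetaChar_sub {ε σ : ℂ} (hε : ε * ε = 1) (hσ : 0 < σ.im) (u v : ℂ) :
    thetaChar ε σ (u + v) * thetaChar ε σ (u - v) =
      thetaChar 1 (2 * σ) u * thetaChar 1 (2 * σ) v +
        ε * (thetaChar 1 (2 * σ) (u + 1 / 2) * thetaChar 1 (2 * σ) (v + 1 / 2)) := by
  have h2 : 0 < (2 * σ).im := im_ofNat_mul_pos hσ 2
  have hs (r : ℂ) := summable_norm_thetaCharTerm hε hσ r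
  have hs1 (r : ℂ) := summable_norm_thetaCharTerm (one_mul (1 : ℂ)) h2 r
  simp only [thetaChar]
  rw [tsum_mul_tsum_of_summable_norm (hs _) (hs _), tsum_mul_tsum_of_summable_norm (hs1 _) (hs1 _),
    tsum_mul_tsum_of_summable_norm (hs1 _) (hs1 _),
    tsum_sum_equiv sumDiffEquiv (summable_mul_of_summable_norm (hs _) (hs _)), ← tsum_mul_left]
  have hε0 := ne_zero_of_mul_self hε
  congr 1
  -- Even case: `(m + n + u + v)² + (m - n + u - v)² = 2(m + u)² + 2(n + v)²`. The odd case replaces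
  -- `m, n` on the right by `m + 1/2, n + 1/2`.
  · refine tsum_congr fun p => ?_
    obtain ⟨m, n⟩ := p
    have h : ε ^ (m + n) * ε ^ (m - n) = 1 := by
      rw [← zpow_add₀ hε0, ← zpow_two_mul_of_mul_self hε m]
      congr 1
      ring
    simp only [thetaCharTerm, sumDiffEquiv, Equiv.coe_fn_mk, Sum.elim_inl, one_zpow, one_mul]
    rw [mul_mul_mul_comm, h, one_mul, ← Complex.exp_add, ← Complex.exp_add]
    push_cast
    congr 1
    ring
  · refine tsum_congr fun p => ?_
    obtain ⟨m, n⟩ := p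
    have h : ε ^ (m + n + 1) * ε ^ (m - n) = ε := by
      rw [← zpow_add₀ hε0, ← one_mul ε, ← zpow_two_mul_of_mul_self hε m,
        zpow_two_mul_of_mul_self hε m, one_mul, show m + n + 1 + (m - n) = 2 * m + 1 by ring,
        zpow_add_one₀ hε0, zpow_two_mul_of_mul_self hε m, one_mul]
    simp only [thetaCharTerm, sumDiffEquiv, Equiv.coe_fn_mk, Sum.elim_inr, one_zpow, one_mul]
    rw [mul_mul_mul_comm, h, ← Complex.exp_add, ← Complex.exp_add]
    push_cast
    congr 2
    ring

/-- Apply the addition formula with `v = 1/4`. The level `4σ` series agrees at `1/4` and `3/4`, so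
it factors out, leaving the even-odd splitting of the level `σ` series. -/
theorem thetaChar_mul_thetaChar_add_half {ε σ : ℂ} (hε : ε * ε = 1) (hσ : 0 < σ.im) (r : ℂ) :
    thetaChar ε (2 * σ) (r + 1 / 2) * thetaChar ε (2 * σ) r =
      thetaChar 1 (4 * σ) (1 / 4) * thetaChar ε σ (2 * r + 1 / 2) := by
  have h := thetaChar_add_mul_thetaChar_sub hε (im_ofNat_mul_pos hσ 2) (r + 1 / 4) (1 / 4)
  have h1 : thetaChar 1 (4 * σ) (1 / 4 + 1 / 2) = thetaChar 1 (4 * σ) (1 / 4) := by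
    have h2 := thetaChar_add_one (one_mul 1) (4 * σ) (-(1 / 4))
    rw [thetaChar_neg (one_mul 1), one_mul] at h2
    rw [← h2]
    congr 1
    norm_num
  rw [← mul_assoc, show (2 * 2 : ℂ) = 4 by norm_num, h1] at h
  rw [thetaChar_eq_even_add_odd hε hσ, show r + 1 / 2 = r + 1 / 4 + 1 / 4 by ring,
    show (2 * r + 1 / 2) / 2 = r + 1 / 4 by ring]
  rw [add_sub_cancel_right] at h
  rw [h]
  ring

/-- Even plus odd part times even minus odd part is a difference of squares, which the addition
formula with `u = v = r / 2` recognises. -/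
theorem thetaChar_neg_one_mul_thetaChar_one {σ : ℂ} (hσ : 0 < σ.im) (r : ℂ) :
    thetaChar (-1) σ r * thetaChar 1 σ r = thetaChar (-1) (2 * σ) r * thetaChar (-1) (2 * σ) 0 := by
  have h := thetaChar_add_mul_thetaChar_sub (ε := -1) (by norm_num) (im_ofNat_mul_pos hσ 2)
    (r / 2) (r / 2)
  rw [← mul_assoc, show (2 * 2 : ℂ) = 4 by norm_num, add_halves, sub_self] at h
  rw [h, thetaChar_eq_even_add_odd (by norm_num) hσ, thetaChar_eq_even_add_odd (by norm_num) hσ]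
  ring

/-- The duplication formula for the four Jacobi theta functions. -/
theorem thetaChar_duplication {σ : ℂ} (hσ : 0 < σ.im) (r : ℂ) :
    2 * (thetaChar (-1) σ (r + 1 / 2) * thetaChar (-1) σ r *
        (thetaChar 1 σ (r + 1 / 2) * thetaChar 1 σ r)) =
      thetaChar 1 σ (1 / 2) * thetaChar 1 σ 0 * thetaChar (-1) σ 0 *
        thetaChar (-1) σ (2 * r + 1 / 2) := by
  -- Halving `σ` lets each pair of factors collapse to level `s`; the resulting product at `2r +
  -- 1/2` then returns to level `2s = σ`.
  obtain ⟨s, rfl⟩ : ∃ s : ℂ, σ = 2 * s := ⟨σ / 2, by ring⟩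
  have hs : 0 < s.im := by simpa using hσ
  have hc := thetaChar_mul_thetaChar_add_half (one_mul 1) hs 0
  have h0 : thetaChar 1 s (1 / 2) = 2 * thetaChar 1 (4 * s) (1 / 4) := by
    have h2 := thetaChar_add_one (one_mul 1) (4 * s) (-(1 / 4))
    rw [thetaChar_neg (one_mul 1), one_mul] at h2
    rw [thetaChar_eq_even_add_odd (one_mul 1) hs, show (1 / 2 / 2 : ℂ) = 1 / 4 by norm_num,
      show (1 / 4 + 1 / 2 : ℂ) = -(1 / 4) + 1 by norm_num, h2]
    ring
  rw [zero_add, mul_zero, zero_add, h0] at hc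
  rw [thetaChar_mul_thetaChar_add_half (by norm_num) hs,
    thetaChar_mul_thetaChar_add_half (one_mul 1) hs, hc]
  have h3 := thetaChar_neg_one_mul_thetaChar_one hs (2 * r + 1 / 2)
  linear_combination 2 * thetaChar 1 (4 * s) (1 / 4) ^ 2 * h3

/-! ### Infinite `q`-products. -/

theorem one_sub_pow_succ_ne_zero {p : ℂ} (hp : ‖p‖ < 1) (n : ℕ) : 1 - p ^ (n + 1) ≠ 0 := by
  intro h
  have h1 : ‖p ^ (n + 1)‖ < 1 := by
    rw [norm_pow]
    exact pow_lt_one₀ (norm_nonneg _) hp n.succ_ne_zero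
  rw [← sub_eq_zero.1 h, norm_one] at h1
  exact lt_irrefl _ h1

theorem qPochInf_ne_zero {a q : ℂ} (hq : ‖q‖ < 1) (h : ∀ k : ℕ, 1 - a * q ^ k ≠ 0) :
    qPochInf a q ≠ 0 := by
  have hs : Summable fun k : ℕ => ‖-(a * q ^ k)‖ := by
    simpa using (summable_geometric_of_lt_one (norm_nonneg _) hq).mul_left ‖a‖
  simpa [qPochInf, sub_eq_add_neg] using
    tprod_one_add_ne_zero_of_summable (by simpa [sub_eq_add_neg] using h) hs

theorem qPochInf_self_ne_zero {p : ℂ} (hp : ‖p‖ < 1) : qPochInf p p ≠ 0 :=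
  qPochInf_ne_zero hp fun k => by
    rw [← pow_succ']
    exact one_sub_pow_succ_ne_zero hp k

theorem qPoch_succ (a q : ℂ) (n : ℕ) : qPoch a q (n + 1) = qPoch a q n * (1 - a * q ^ n) :=
  Finset.prod_range_succ _ _

theorem qPoch_mul_index (a q : ℂ) (m n : ℕ) :
    qPoch a q (m * n) = ∏ j ∈ Finset.range m, qPoch (a * q ^ j) (q ^ m) n := by
  induction n with
  | zero => simp [qPoch]
  | succ n ih =>
    simp only [qPoch_succ, Finset.prod_mul_distrib, ← ih]
    rw [Nat.mul_succ, qPoch, Finset.prod_range_add, qPoch]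
    congr 1
    refine Finset.prod_congr rfl fun j _ => ?_
    rw [pow_add, pow_mul]
    ring

/-- Splitting a `q`-product according to the residues of the exponents. -/
theorem qPochInf_eq_prod (a : ℂ) {q : ℂ} (hq : ‖q‖ < 1) {m : ℕ} (hm : m ≠ 0) :
    qPochInf a q = ∏ j ∈ Finset.range m, qPochInf (a * q ^ j) (q ^ m) := by
  have hqm : ‖q ^ m‖ < 1 := by
    rw [norm_pow]
    exact pow_lt_one₀ (norm_nonneg _) hq hm
  have h1 : Tendsto (fun n => qPoch a q (m * n)) atTop (𝓝 (qPochInf a q)) :=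
    (tendsto_qPoch a hq).comp (tendsto_id.const_mul_atTop' (Nat.pos_of_ne_zero hm))
  refine tendsto_nhds_unique h1 ?_
  simp only [qPoch_mul_index]
  exact tendsto_finsetProd _ fun j _ => tendsto_qPoch _ hqm

theorem qPochInf_mul_qPochInf_neg (a : ℂ) {q : ℂ} (hq : ‖q‖ < 1) :
    qPochInf a q * qPochInf (-a) q = qPochInf (a ^ 2) (q ^ 2) := by
  have hq2 : ‖q ^ 2‖ < 1 := by
    rw [norm_pow]
    exact pow_lt_one₀ (norm_nonneg _) hq two_ne_zero
  refine tendsto_nhds_unique ((tendsto_qPoch a hq).mul (tendsto_qPoch (-a) hq)) ?_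
  refine (tendsto_qPoch (a ^ 2) hq2).congr fun n => ?_
  rw [qPoch, qPoch, qPoch, ← Finset.prod_mul_distrib]
  refine Finset.prod_congr rfl fun k _ => ?_
  ring

theorem qPochInf_eq_one_sub_mul (a : ℂ) {q : ℂ} (hq : ‖q‖ < 1) :
    qPochInf a q = (1 - a) * qPochInf (a * q) q := by
  have h1 := (tendsto_qPoch a hq).comp (tendsto_add_atTop_nat 1)
  refine tendsto_nhds_unique h1 (((tendsto_qPoch (a * q) hq).const_mul (1 - a)).congr fun n => ?_)
  rw [Function.comp_apply, qPoch, qPoch, Finset.prod_range_succ', pow_zero, mul_one, mul_comm]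
  congr 1
  refine Finset.prod_congr rfl fun k _ => ?_
  ring

/-- Euler's identity `(-p; p)_∞ (p; p ^ 2)_∞ = 1`. -/
theorem qPochInf_neg_mul_qPochInf_sq {p : ℂ} (hp : ‖p‖ < 1) :
    qPochInf (-p) p * qPochInf p (p ^ 2) = 1 := by
  have hp2 : ‖p ^ 2‖ < 1 := by
    rw [norm_pow]
    exact pow_lt_one₀ (norm_nonneg _) hp two_ne_zero
  have h1 := qPochInf_mul_qPochInf_neg p hp
  have h2 := qPochInf_eq_prod p hp two_ne_zero
  rw [Finset.prod_range_succ, Finset.prod_range_one, pow_zero, mul_one, pow_one, ← pow_two] at h2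
  rw [h2] at h1
  refine mul_right_cancel₀ (qPochInf_self_ne_zero hp2) ?_
  linear_combination h1

/-! ### The Jacobi triple product, as a limit of a finite identity. -/

/-- The reciprocal of `(p; p)_n`, extended by zero to negative `n`. -/
noncomputable def invQPoch (p : ℂ) (n : ℤ) : ℂ := if 0 ≤ n then (qPoch p p n.toNat)⁻¹ else 0

/-- At `n = 0` the factor `1 - p ^ n` vanishes, in agreement with the extension by zero, so no
boundary cases arise later. -/
theorem invQPoch_sub_one {p : ℂ} (hp : ‖p‖ < 1) (n : ℤ) :
    invQPoch p (n - 1) = (1 - p ^ n) * invQPoch p n := by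
  rcases lt_trichotomy n 0 with h | rfl | h
  · rw [invQPoch, invQPoch, if_neg (by omega), if_neg (by omega), mul_zero]
  · simp [invQPoch]
  · obtain ⟨m, rfl⟩ : ∃ m : ℕ, n = m + 1 := ⟨(n - 1).toNat, by omega⟩
    have h1 : 1 - p * p ^ m ≠ 0 := by
      rw [← pow_succ']
      exact one_sub_pow_succ_ne_zero hp m
    rw [invQPoch, invQPoch, if_pos (by omega), if_pos (by omega), add_sub_cancel_right,
      show ((m : ℤ) + 1).toNat = m + 1 by omega, Int.toNat_natCast, qPoch_succ, mul_inv,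
      show (p : ℂ) ^ ((m : ℤ) + 1) = p * p ^ m by rw [← pow_succ']; exact_mod_cast rfl]
    field_simp

/-- The coefficients of the finite form of the triple product. -/
noncomputable def tripleCoeff (p : ℂ) (N : ℕ) (j : ℤ) : ℂ :=
  qPoch p p (2 * N) * (invQPoch p (N - j) * invQPoch p (N + j))

/-- The coefficients are the Gaussian binomials `[2N, N + j]`; this is the double Pascal rule that
matches multiplication by `(1 - x p^N)(1 - p^(N+1) / x)`. -/
theorem tripleCoeff_succ {p : ℂ} (hp0 : p ≠ 0) (hp : ‖p‖ < 1) (N : ℕ) (j : ℤ) :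
    tripleCoeff p (N + 1) j = (1 + p ^ (2 * N + 1)) * tripleCoeff p N j +
      p ^ ((N : ℤ) - j + 1) * tripleCoeff p N (j - 1) +
        p ^ ((N : ℤ) + j + 1) * tripleCoeff p N (j + 1) := by
  have e1 := invQPoch_sub_one hp (N - j + 1)
  have e2 := invQPoch_sub_one hp (N - j)
  have e3 := invQPoch_sub_one hp (N + j + 1)
  have e4 := invQPoch_sub_one hp (N + j)
  rw [add_sub_cancel_right] at e1 e3
  simp only [tripleCoeff]
  rw [show ((N + 1 : ℕ) : ℤ) - j = N - j + 1 by push_cast; ring,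
    show ((N + 1 : ℕ) : ℤ) + j = N + j + 1 by push_cast; ring,
    show (N : ℤ) - (j - 1) = N - j + 1 by ring, show (N : ℤ) + (j - 1) = N + j - 1 by ring,
    show (N : ℤ) - (j + 1) = N - j - 1 by ring, show (N : ℤ) + (j + 1) = N + j + 1 by ring,
    e2, e4, e1, e3, show 2 * (N + 1) = 2 * N + 1 + 1 by ring, qPoch_succ, qPoch_succ,
    zpow_add_one₀ hp0, zpow_add_one₀ hp0]
  have h : p ^ (2 * N) = p ^ ((N : ℤ) - j) * p ^ ((N : ℤ) + j) := by
    rw [← zpow_add₀ hp0, ← zpow_natCast]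
    congr 1
    push_cast
    ring
  rw [pow_succ, h]
  ring

/-- The general term of the series in the triple product identity. -/
noncomputable def tripleTerm (p x : ℂ) (n : ℤ) : ℂ := (-1) ^ n * p ^ (n * (n - 1) / 2) * x ^ n

theorem tripleTerm_add_one {p x : ℂ} (hp0 : p ≠ 0) (hx : x ≠ 0) (n : ℤ) :
    tripleTerm p x (n + 1) = -(x * p ^ n) * tripleTerm p x n := by
  have h : (n + 1) * (n + 1 - 1) / 2 = n * (n - 1) / 2 + n := by
    rw [show (n + 1) * (n + 1 - 1) = n * (n - 1) + n * 2 by ring]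
    exact Int.add_mul_ediv_right _ _ two_ne_zero
  rw [tripleTerm, tripleTerm, h, zpow_add₀ hp0, zpow_add_one₀ hx, zpow_add_one₀ (by norm_num)]
  ring

/-- The finite form of the Jacobi triple product. -/
theorem hasSum_tripleCoeff_mul {p x : ℂ} (hp0 : p ≠ 0) (hp : ‖p‖ < 1) (hx : x ≠ 0) (N : ℕ) :
    HasSum (fun j => tripleCoeff p N j * tripleTerm p x j) (qPoch x p N * qPoch (p / x) p N) := by
  induction N with
  | zero =>
    convert hasSum_single (0 : ℤ) ?_ using 1
    · simp [qPoch, tripleCoeff, tripleTerm, invQPoch]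
    · intro j hj
      have : ¬ (0 ≤ -j ∧ 0 ≤ j) := by omega
      rw [not_and_or] at this
      rcases this with h | h <;> simp only [tripleCoeff, invQPoch, Nat.cast_zero, zero_sub,
        zero_add, if_neg h, zero_mul, mul_zero]
  | succ N ih =>
    have h1 := (Equiv.subRight (1 : ℤ)).hasSum_iff.2 ih
    have h2 := (Equiv.addRight (1 : ℤ)).hasSum_iff.2 ih
    convert! ((ih.mul_left (1 + p ^ (2 * N + 1))).add (h1.mul_left (-(x * p ^ N)))).add
      (h2.mul_left (-(p ^ (N + 1) / x))) using 1
    · funext j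
      simp only [Function.comp_apply, Equiv.subRight_apply, Equiv.coe_addRight]
      have e2 := tripleTerm_add_one hp0 hx (j - 1)
      rw [sub_add_cancel] at e2
      have e3 : p ^ ((N : ℤ) - j + 1) * p ^ (j - 1) = p ^ N := by
        rw [← zpow_add₀ hp0, ← zpow_natCast]
        congr 1
        ring
      rw [tripleCoeff_succ hp0 hp, tripleTerm_add_one hp0 hx j]
      have e4 : p ^ ((N : ℤ) + j + 1) = p ^ (N + 1) * p ^ j := by
        rw [← zpow_natCast, ← zpow_add₀ hp0]
        congr 1
        push_cast
        ring
      rw [e4, e2, ← e3]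
      field_simp
      ring
    · rw [qPoch_succ, qPoch_succ]
      field_simp
      ring

theorem tendsto_invQPoch {p : ℂ} (hp : ‖p‖ < 1) (j : ℤ) :
    Tendsto (fun N : ℕ => invQPoch p (N + j)) atTop (𝓝 (qPochInf p p)⁻¹) := by
  have h1 : Tendsto (fun n : ℤ => invQPoch p n) atTop (𝓝 (qPochInf p p)⁻¹) := by
    rw [← Nat.map_cast_int_atTop, tendsto_map'_iff]
    refine ((tendsto_qPoch p hp).inv₀ (qPochInf_self_ne_zero hp)).congr fun n => ?_
    simp [invQPoch]
  exact h1.comp (tendsto_atTop_add_const_right _ _ tendsto_natCast_atTop_atTop)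

/-- Uniformity in both `N` and `j` supplies the domination needed to pass to the limit under the
sum. -/
theorem exists_norm_tripleCoeff_le {p : ℂ} (hp : ‖p‖ < 1) :
    ∃ C : ℝ, ∀ N j, ‖tripleCoeff p N j‖ ≤ C := by
  obtain ⟨A, hA⟩ := (tendsto_qPoch p hp).norm.bddAbove_range
  obtain ⟨B, hB⟩ :=
    ((tendsto_qPoch p hp).inv₀ (qPochInf_self_ne_zero hp)).norm.bddAbove_range
  have hA' (n : ℕ) : ‖qPoch p p n‖ ≤ A := hA ⟨n, rfl⟩
  have hB' (n : ℕ) : ‖(qPoch p p n)⁻¹‖ ≤ B := hB ⟨n, rfl⟩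
  have hB0 : 0 ≤ B := (norm_nonneg _).trans (hB' 0)
  have hB2 (n : ℤ) : ‖invQPoch p n‖ ≤ B := by
    rw [invQPoch]
    split_ifs
    · exact hB' _
    · simpa using hB0
  refine ⟨A * (B * B), fun N j => ?_⟩
  rw [tripleCoeff, norm_mul, norm_mul]
  have hA0 : 0 ≤ A := (norm_nonneg _).trans (hA' 0)
  gcongr <;> first | exact hA' _ | exact hB2 _

theorem tendsto_tripleCoeff {p : ℂ} (hp : ‖p‖ < 1) (j : ℤ) :
    Tendsto (fun N => tripleCoeff p N j) atTop (𝓝 (qPochInf p p)⁻¹) := by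
  have h0 := qPochInf_self_ne_zero hp
  have h1 : Tendsto (fun N : ℕ => qPoch p p (2 * N)) atTop (𝓝 (qPochInf p p)) :=
    (tendsto_qPoch p hp).comp (tendsto_id.const_mul_atTop' two_pos)
  have h2 := h1.mul ((tendsto_invQPoch hp (-j)).mul (tendsto_invQPoch hp j))
  rw [mul_inv_cancel_left₀ h0] at h2
  exact h2

/-- **Jacobi triple product identity**. -/
theorem tsum_tripleTerm {p x : ℂ} (hp0 : p ≠ 0) (hp : ‖p‖ < 1) (hx : x ≠ 0)
    (hs : Summable fun n => ‖tripleTerm p x n‖) :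
    ∑' n, tripleTerm p x n = qPochInf x p * qPochInf (p / x) p * qPochInf p p := by
  obtain ⟨C, hC⟩ := exists_norm_tripleCoeff_le hp
  have h1 := tendsto_tsum_of_dominated_convergence (𝓕 := atTop)
    (f := fun (N : ℕ) j => tripleCoeff p N j * tripleTerm p x j) (hs.mul_left C)
    (fun j => (tendsto_tripleCoeff hp j).mul_const (tripleTerm p x j))
    (Eventually.of_forall fun N j => by
      rw [norm_mul]
      exact mul_le_mul_of_nonneg_right (hC N j) (norm_nonneg _))
  simp only [(hasSum_tripleCoeff_mul hp0 hp hx _).tsum_eq, tsum_mul_left] at h1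
  have h2 := tendsto_nhds_unique h1 ((tendsto_qPoch x hp).mul (tendsto_qPoch (p / x) hp))
  rw [← h2, mul_comm, mul_inv_cancel_left₀ (qPochInf_self_ne_zero hp)]

/-- Completing the square turns the theta series into the triple product series with `p =
exp(2πiσ)`; `ε² = 1` gives `p / x` the same shape as `x`. -/
theorem thetaChar_eq_qPochInf {ε σ : ℂ} (hε : ε * ε = 1) (hσ : 0 < σ.im) (r : ℂ) :
    thetaChar ε σ r = cexp (Real.pi * I * σ * r ^ 2) *
      (qPochInf (-(ε * cexp (Real.pi * I * σ * (1 + 2 * r)))) (cexp (2 * Real.pi * I * σ)) *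
        qPochInf (-(ε * cexp (Real.pi * I * σ * (1 - 2 * r)))) (cexp (2 * Real.pi * I * σ)) *
          qPochInf (cexp (2 * Real.pi * I * σ)) (cexp (2 * Real.pi * I * σ))) := by
  have hε0 := ne_zero_of_mul_self hε
  set p := cexp (2 * Real.pi * I * σ) with hp
  set x := -(ε * cexp (Real.pi * I * σ * (1 + 2 * r))) with hx
  have hp1 : ‖p‖ < 1 := by
    rw [hp, Complex.norm_exp, Real.exp_lt_one_iff]
    have : (2 * Real.pi * I * σ).re = -(2 * Real.pi * σ.im) := by simp
    rw [this]
    have := Real.pi_pos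
    have : 0 < 2 * Real.pi * σ.im := by positivity
    linarith
  have hx0 : x ≠ 0 := neg_ne_zero.2 (mul_ne_zero hε0 (Complex.exp_ne_zero _))
  have hterm (n : ℤ) :
      thetaCharTerm ε σ r n = cexp (Real.pi * I * σ * r ^ 2) * tripleTerm p x n := by
    have h1 : p ^ (n * (n - 1) / 2) = cexp (Real.pi * I * σ * (n * (n - 1))) := by
      rw [hp, ← Complex.exp_int_mul]
      have h2 : (2 : ℤ) * (n * (n - 1) / 2) = n * (n - 1) :=
        Int.mul_ediv_cancel' (by rw [mul_comm]; simpa using (Int.even_mul_succ_self (n - 1)).two_dvd)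
      have h3 : (2 : ℂ) * ((n * (n - 1) / 2 : ℤ) : ℂ) = n * (n - 1) := by
        exact_mod_cast congrArg (Int.cast : ℤ → ℂ) h2
      congr 1
      linear_combination (Real.pi * I * σ) * h3
    have h4 : x ^ n = (-1) ^ n * ε ^ n * cexp (n * (Real.pi * I * σ * (1 + 2 * r))) := by
      rw [hx, ← neg_one_mul, mul_zpow, mul_zpow, Complex.exp_int_mul, ← mul_assoc]
    have h5 : (-1 : ℂ) ^ n * (-1) ^ n = 1 := by rw [← mul_zpow]; norm_num
    rw [thetaCharTerm, tripleTerm, h1, h4, show ∀ a b c d e : ℂ,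
      a * (b * c * (b * d * e)) = b * b * (d * (a * c * e)) by intros; ring, h5, one_mul,
      ← Complex.exp_add, ← Complex.exp_add]
    congr 2
    ring
  have hs : Summable fun n => ‖tripleTerm p x n‖ := by
    refine ((summable_norm_thetaCharTerm hε hσ r).mul_left
      ‖(cexp (Real.pi * I * σ * r ^ 2))⁻¹‖).congr fun n => ?_
    rw [hterm, ← norm_mul, inv_mul_cancel_left₀ (Complex.exp_ne_zero _)]
  have hpx : p / x = -(ε * cexp (Real.pi * I * σ * (1 - 2 * r))) := by
    rw [div_eq_iff hx0, hx, neg_mul_neg, mul_mul_mul_comm, hε, one_mul, ← Complex.exp_add, hp]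
    congr 1
    ring
  rw [← hpx, ← tsum_tripleTerm (Complex.exp_ne_zero _) hp1 hx0 hs, thetaChar, ← tsum_mul_left]
  exact tsum_congr hterm

/-! ### Algebra on the Klein quartic. -/

/-- The discriminant of a product of three linear forms. -/
theorem discrim_prod_linear {R : Type*} [CommRing R] (m₁ m₂ m₃ n₁ n₂ n₃ : R) :
    18 * (m₁ * m₂ * m₃) * (m₁ * m₂ * n₃ + m₁ * n₂ * m₃ + n₁ * m₂ * m₃) *
        (m₁ * n₂ * n₃ + n₁ * m₂ * n₃ + n₁ * n₂ * m₃) * (n₁ * n₂ * n₃) -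
      4 * (m₁ * m₂ * n₃ + m₁ * n₂ * m₃ + n₁ * m₂ * m₃) ^ 3 * (n₁ * n₂ * n₃) +
      (m₁ * m₂ * n₃ + m₁ * n₂ * m₃ + n₁ * m₂ * m₃) ^ 2 *
        (m₁ * n₂ * n₃ + n₁ * m₂ * n₃ + n₁ * n₂ * m₃) ^ 2 -
      4 * (m₁ * m₂ * m₃) * (m₁ * n₂ * n₃ + n₁ * m₂ * n₃ + n₁ * n₂ * m₃) ^ 3 -
      27 * (m₁ * m₂ * m₃) ^ 2 * (n₁ * n₂ * n₃) ^ 2 =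
    ((m₁ * n₂ - m₂ * n₁) * (m₁ * n₃ - m₃ * n₁) * (m₂ * n₃ - m₃ * n₂)) ^ 2 := by
  ring

section Algebra

variable {a b c : ℂ}

/-- The coefficients of a cubic with prescribed values at the multiples of a point of order
seven. -/
theorem cubic_coeff_eq (ha : a ≠ 0) (hb : b ≠ 0) (hc : c ≠ 0)
    (hk : a ^ 3 * b + b ^ 3 * c + c ^ 3 * a = 0) {d₁ d₂ : ℂ}
    (h₂ : b ^ 2 / a ^ 2 * (b ^ 2) ^ 3 + d₂ * (b ^ 2) ^ 2 * (c * a) + d₁ * b ^ 2 * (c * a) ^ 2 +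
      4 * (c * a) ^ 3 = a ^ 6 * (c ^ 2 / b ^ 2))
    (h₃ : b ^ 2 / a ^ 2 * (c ^ 2) ^ 3 + d₂ * (c ^ 2) ^ 2 * (-(b * c)) +
      d₁ * c ^ 2 * (-(b * c)) ^ 2 + 4 * (-(b * c)) ^ 3 = a ^ 6 * (a ^ 2 / c ^ 2)) :
    d₂ * (a ^ 3 * b * c) = -2 * (b ^ 5 + a ^ 4 * c) ∧
      d₁ * (a ^ 4 * b ^ 4 * c ^ 2) = (b ^ 5 + a ^ 4 * c) ^ 2 - 4 * a ^ 5 * b ^ 2 * c ^ 3 := by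
  set e₂ := d₂ * (a ^ 3 * b * c) + 2 * (b ^ 5 + a ^ 4 * c) with he₂
  set e₁ := d₁ * (a ^ 4 * b ^ 4 * c ^ 2) - ((b ^ 5 + a ^ 4 * c) ^ 2 - 4 * a ^ 5 * b ^ 2 * c ^ 3)
    with he₁
  field_simp at h₂ h₃
  -- The errors `e₁, e₂` in the claimed coefficients solve a homogeneous 2×2 system; modulo the
  -- Klein quartic its determinant is `(abc)³` up to sign.
  have h₂' : b ^ 5 * e₂ + e₁ = 0 := by
    rw [he₂, he₁]
    linear_combination h₂
  have h₃' : -(a * b ^ 2 * c ^ 6) * e₂ + c ^ 4 * e₁ = 0 := by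
    rw [he₂, he₁]
    linear_combination (a ^ 2 * b ^ 2) * h₃ -
      (c ^ 2 * b ^ 4 * (a ^ 3 * b + b ^ 3 * c + c ^ 3 * a) +
        2 * c ^ 2 * b ^ 2 * (a ^ 4 * c ^ 2 - a ^ 3 * b ^ 3) - 4 * a ^ 4 * b ^ 2 * c ^ 4 +
        a ^ 6 * (b ^ 3 * c + c ^ 3 * a - a ^ 3 * b)) * hk
  have h₂₀ : e₂ = 0 := by
    have h : (a * b * c) ^ 3 * e₂ = 0 := by
      linear_combination (-c ^ 4) * h₂' + h₃' + (b ^ 2 * c ^ 3 * e₂) * hk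
    exact (mul_eq_zero.1 h).resolve_left (by positivity)
  have h₁₀ : e₁ = 0 := by
    rw [h₂₀] at h₂'
    linear_combination h₂'
  exact ⟨by linear_combination h₂₀, by linear_combination h₁₀⟩

theorem septic_discriminant (ha : a ≠ 0) (hb : b ≠ 0) (hc : c ≠ 0)
    (hk : a ^ 3 * b + b ^ 3 * c + c ^ 3 * a = 0) {d₁ d₂ K : ℂ}
    (h₂ : d₂ * (a ^ 3 * b * c) = -2 * (b ^ 5 + a ^ 4 * c))
    (h₁ : d₁ * (a ^ 4 * b ^ 4 * c ^ 2) = (b ^ 5 + a ^ 4 * c) ^ 2 - 4 * a ^ 5 * b ^ 2 * c ^ 3)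
    (hd : K ^ 4 * (18 * (b ^ 2 / a ^ 2) * d₂ * d₁ * 4 - 4 * d₂ ^ 3 * 4 + d₂ ^ 2 * d₁ ^ 2 -
      4 * (b ^ 2 / a ^ 2) * d₁ ^ 3 - 27 * (b ^ 2 / a ^ 2) ^ 2 * 4 ^ 2) = 16 * a ^ 12) :
    (a * b * c) ^ 4 = -K ^ 4 *
      (b ^ 2 * c / a ^ 3 + c ^ 2 * a / b ^ 3 + a ^ 2 * b / c ^ 3 + 8) := by
  have h₂' : d₂ = -2 * (b ^ 5 + a ^ 4 * c) / (a ^ 3 * b * c) := by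
    rw [eq_div_iff (by positivity), h₂]
  have h₁' : d₁ = ((b ^ 5 + a ^ 4 * c) ^ 2 - 4 * a ^ 5 * b ^ 2 * c ^ 3) /
      (a ^ 4 * b ^ 4 * c ^ 2) := by
    rw [eq_div_iff (by positivity), h₁]
  rw [h₂', h₁'] at hd
  field_simp at hd ⊢
  refine mul_left_cancel₀ (show 16 * a ^ 19 * b ^ 3 ≠ 0 by simp [ha, hb]) ?_
  linear_combination (-c) * hd + 16 * K ^ 4 * a ^ 9 * b ^ 2 *
    (a ^ 12 * b ^ 4 + a ^ 11 * c ^ 5 + 7 * a ^ 10 * b ^ 3 * c ^ 3 - a ^ 9 * b ^ 6 * c -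
      8 * a ^ 8 * b ^ 2 * c ^ 6 - 5 * a ^ 7 * b ^ 5 * c ^ 4 + a ^ 6 * b ^ 8 * c ^ 2 +
      16 * a ^ 5 * b ^ 4 * c ^ 7 + 4 * a ^ 4 * b ^ 7 * c ^ 5 - a ^ 3 * b ^ 10 * c ^ 3 +
      b ^ 12 * c ^ 4) * hk

/-- The relations between the theta constants of order seven that follow from the addition and
duplication formulas. -/
theorem septic_relations_of_brackets (ha : a ≠ 0) (hb : b ≠ 0) (hc : c ≠ 0) {K : ℂ} (hK : K ≠ 0)
    {f g β₁ γ₁ β₂ γ₂ β₃ γ₃ : ℂ}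
    (h₁ : γ₁ * f - β₁ * g = a ^ 2) (h₂ : γ₂ * f - β₂ * g = b ^ 2) (h₃ : γ₃ * f - β₃ * g = c ^ 2)
    (h₂₁ : γ₂ * β₁ - β₂ * γ₁ = -(c * a)) (h₃₁ : γ₃ * β₁ - β₃ * γ₁ = b * c)
    (h₃₂ : γ₃ * β₂ - β₃ * γ₂ = -(a * b))
    (h₀ : 2 * f * g * (f ^ 2 - g ^ 2) * (f ^ 2 + g ^ 2) = 4 * K ^ 2)
    (hd₁ : a ^ 2 * ((γ₁ * f + β₁ * g) * (β₁ * f - γ₁ * g) * (β₁ * f + γ₁ * g)) = K ^ 2 * b ^ 2)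
    (hd₂ : b ^ 2 * ((γ₂ * f + β₂ * g) * (β₂ * f - γ₂ * g) * (β₂ * f + γ₂ * g)) = K ^ 2 * c ^ 2)
    (hd₃ : c ^ 2 * ((γ₃ * f + β₃ * g) * (β₃ * f - γ₃ * g) * (β₃ * f + γ₃ * g)) = K ^ 2 * a ^ 2) :
    a ^ 3 * b + b ^ 3 * c + c ^ 3 * a = 0 ∧
      (a * b * c) ^ 4 = -K ^ 4 *
        (b ^ 2 * c / a ^ 3 + c ^ 2 * a / b ^ 3 + a ^ 2 * b / c ^ 3 + 8) := by
  have hk : a ^ 3 * b + b ^ 3 * c + c ^ 3 * a = 0 := by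
    -- The Plücker relation among the six brackets.
    linear_combination (γ₃ * β₂ - β₃ * γ₂) * h₁ - (γ₃ * β₁ - β₃ * γ₁) * h₂ +
      (γ₂ * β₁ - β₂ * γ₁) * h₃ + a ^ 2 * h₃₂ - b ^ 2 * h₃₁ + c ^ 2 * h₂₁
  refine ⟨hk, ?_⟩
  -- Cramer's rule: the vectors at `2/7` and `3/7` in the basis formed by those at `1/7` and `0`.
  have hβ₂ : a ^ 2 * β₂ = b ^ 2 * β₁ + c * a * f := by
    linear_combination -β₂ * h₁ + β₁ * h₂ - f * h₂₁
  have hγ₂ : a ^ 2 * γ₂ = b ^ 2 * γ₁ + c * a * g := by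
    linear_combination -γ₂ * h₁ + γ₁ * h₂ - g * h₂₁
  have hβ₃ : a ^ 2 * β₃ = c ^ 2 * β₁ + -(b * c) * f := by
    linear_combination -β₃ * h₁ + β₁ * h₃ - f * h₃₁
  have hγ₃ : a ^ 2 * γ₃ = c ^ 2 * γ₁ + -(b * c) * g := by
    linear_combination -γ₃ * h₁ + γ₁ * h₃ - g * h₃₁
  -- The three linear forms evaluated at `0` (the `nᵢ`) and at `1/7` (the `mᵢ`).
  obtain ⟨n₁, hn₁⟩ : ∃ n, n = 2 * f * g := ⟨_, rfl⟩
  obtain ⟨n₂, hn₂⟩ : ∃ n, n = f ^ 2 - g ^ 2 := ⟨_, rfl⟩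
  obtain ⟨n₃, hn₃⟩ : ∃ n, n = f ^ 2 + g ^ 2 := ⟨_, rfl⟩
  obtain ⟨m₁, hm₁⟩ : ∃ m, m = γ₁ * f + β₁ * g := ⟨_, rfl⟩
  obtain ⟨m₂, hm₂⟩ : ∃ m, m = β₁ * f - γ₁ * g := ⟨_, rfl⟩
  obtain ⟨m₃, hm₃⟩ : ∃ m, m = β₁ * f + γ₁ * g := ⟨_, rfl⟩
  -- Each minor is the bracket `a²` times, up to sign, the remaining `nᵢ`.
  have hdet : (m₁ * n₂ - m₂ * n₁) * (m₁ * n₃ - m₃ * n₁) * (m₂ * n₃ - m₃ * n₂) =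
      -(4 * a ^ 6 * K ^ 2) := by
    have e₁ : m₁ * n₂ - m₂ * n₁ = a ^ 2 * n₃ := by
      rw [← h₁, hm₁, hn₂, hm₂, hn₁, hn₃]; ring
    have e₂ : m₁ * n₃ - m₃ * n₁ = a ^ 2 * n₂ := by
      rw [← h₁, hm₁, hn₂, hm₃, hn₁, hn₃]; ring
    have e₃ : m₂ * n₃ - m₃ * n₂ = -(a ^ 2 * n₁) := by
      rw [← h₁, hm₂, hn₂, hm₃, hn₁, hn₃]; ring
    rw [← hn₁, ← hn₂, ← hn₃] at h₀
    rw [e₁, e₂, e₃]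
    linear_combination (-a ^ 6) * h₀
  have hl₂ : (b ^ 2 * m₁ + c * a * n₁) * (b ^ 2 * m₂ + c * a * n₂) * (b ^ 2 * m₃ + c * a * n₃) *
      b ^ 2 = a ^ 6 * (K ^ 2 * c ^ 2) := by
    have e₁ : b ^ 2 * m₁ + c * a * n₁ = a ^ 2 * (γ₂ * f + β₂ * g) := by
      rw [hm₁, hn₁]; linear_combination (-f) * hγ₂ - g * hβ₂
    have e₂ : b ^ 2 * m₂ + c * a * n₂ = a ^ 2 * (β₂ * f - γ₂ * g) := by
      rw [hm₂, hn₂]; linear_combination (-f) * hβ₂ + g * hγ₂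
    have e₃ : b ^ 2 * m₃ + c * a * n₃ = a ^ 2 * (β₂ * f + γ₂ * g) := by
      rw [hm₃, hn₃]; linear_combination (-f) * hβ₂ - g * hγ₂
    rw [e₁, e₂, e₃]
    linear_combination a ^ 6 * hd₂
  have hl₃ : (c ^ 2 * m₁ + -(b * c) * n₁) * (c ^ 2 * m₂ + -(b * c) * n₂) *
      (c ^ 2 * m₃ + -(b * c) * n₃) * c ^ 2 = a ^ 6 * (K ^ 2 * a ^ 2) := by
    have e₁ : c ^ 2 * m₁ + -(b * c) * n₁ = a ^ 2 * (γ₃ * f + β₃ * g) := by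
      rw [hm₁, hn₁]; linear_combination (-f) * hγ₃ - g * hβ₃
    have e₂ : c ^ 2 * m₂ + -(b * c) * n₂ = a ^ 2 * (β₃ * f - γ₃ * g) := by
      rw [hm₂, hn₂]; linear_combination (-f) * hβ₃ + g * hγ₃
    have e₃ : c ^ 2 * m₃ + -(b * c) * n₃ = a ^ 2 * (β₃ * f + γ₃ * g) := by
      rw [hm₃, hn₃]; linear_combination (-f) * hβ₃ - g * hγ₃
    rw [e₁, e₂, e₃]
    linear_combination a ^ 6 * hd₃
  have hdisc := discrim_prod_linear m₁ m₂ m₃ n₁ n₂ n₃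
  rw [hdet] at hdisc
  have hc₀ : n₁ * n₂ * n₃ = K ^ 2 * 4 := by
    rw [hn₁, hn₂, hn₃, h₀, mul_comm]
  have hc₃ : m₁ * m₂ * m₃ = K ^ 2 * (b ^ 2 / a ^ 2) := by
    rw [hm₁, hm₂, hm₃, ← mul_div_assoc, eq_div_iff (pow_ne_zero 2 ha), ← hd₁, mul_comm]
  -- The outer coefficients of the cubic are known from the values at `0` and `1/7`; the middle
  -- ones, scaled by `K²`, will come from the values at `2/7` and `3/7`.
  obtain ⟨d₂, hd₂⟩ : ∃ d, m₁ * m₂ * n₃ + m₁ * n₂ * m₃ + n₁ * m₂ * m₃ = K ^ 2 * d :=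
    ⟨_, (mul_div_cancel₀ _ (pow_ne_zero 2 hK)).symm⟩
  obtain ⟨d₁, hd₁⟩ : ∃ d, m₁ * n₂ * n₃ + n₁ * m₂ * n₃ + n₁ * n₂ * m₃ = K ^ 2 * d :=
    ⟨_, (mul_div_cancel₀ _ (pow_ne_zero 2 hK)).symm⟩
  rw [hc₀, hc₃, hd₁, hd₂] at hdisc
  have hexp (s t : ℂ) : (s * m₁ + t * n₁) * (s * m₂ + t * n₂) * (s * m₃ + t * n₃) =
      K ^ 2 * (b ^ 2 / a ^ 2 * s ^ 3 + d₂ * s ^ 2 * t + d₁ * s * t ^ 2 + 4 * t ^ 3) := by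
    linear_combination s ^ 3 * hc₃ + s ^ 2 * t * hd₂ + s * t ^ 2 * hd₁ + t ^ 3 * hc₀
  rw [hexp] at hl₂ hl₃
  have hK2 := pow_ne_zero 2 hK
  obtain ⟨r₂, r₁⟩ := cubic_coeff_eq ha hb hc hk (d₁ := d₁) (d₂ := d₂)
    (by
      refine mul_left_cancel₀ hK2 ?_
      rw [← mul_div_assoc, ← mul_div_assoc, eq_div_iff (pow_ne_zero 2 hb), hl₂]
      ring)
    (by
      refine mul_left_cancel₀ hK2 ?_
      rw [← mul_div_assoc, ← mul_div_assoc, eq_div_iff (pow_ne_zero 2 hc), hl₃]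
      ring)
  refine septic_discriminant ha hb hc hk r₂ r₁ ?_
  refine mul_left_cancel₀ (pow_ne_zero 4 hK) ?_
  linear_combination hdisc

/-- The four septic identities as rational identities on the Klein quartic. Here `e` and `e'` stand
for the two Euler products. -/
theorem septic_identities (ha : a ≠ 0) (hb : b ≠ 0) (hc : c ≠ 0) {K q e e' x y z : ℂ}
    (hK : K ≠ 0) (hq : q ≠ 0) (he : e ≠ 0) (he' : e' ≠ 0)
    (hk : a ^ 3 * b + b ^ 3 * c + c ^ 3 * a = 0)
    (ht : (a * b * c) ^ 4 = -K ^ 4 *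
      (b ^ 2 * c / a ^ 3 + c ^ 2 * a / b ^ 3 + a ^ 2 * b / c ^ 3 + 8))
    (h₁ : e ^ 4 / (q * e' ^ 4) = (a * b * c) ^ 4 / K ^ 4)
    (h₂ : q ^ 2 * (e' ^ 7 / e) = -(K ^ 3 / (a * b * c)))
    (hx : x = K * (b / c ^ 2)) (hy : y = -K * (a / b ^ 2)) (hz : z = K * (c / a ^ 2)) :
    e ^ 4 / (q * e' ^ 4) = (z ^ 2 - x * z - y ^ 2 - 6 * y * z) / (y * z) ∧
    q ^ 2 * (e' ^ 7 / e) = x * y * z ∧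
    q * e ^ 3 * e' ^ 3 = x * (z ^ 2 - y ^ 2 + 6 * x * y - 7 * x * z) ∧
    e ^ 7 / e' = x ^ 3 - 32 * x ^ 2 * y + 13 * x * y ^ 2 - y ^ 3 + 45 * x ^ 2 * z -
      13 * x * z ^ 2 + z ^ 3 := by
  have hy0 : y ≠ 0 := by
    rw [hy]; exact mul_ne_zero (neg_ne_zero.2 hK) (div_ne_zero ha (pow_ne_zero 2 hb))
  have hz0 : z ≠ 0 := by
    rw [hz]; exact mul_ne_zero hK (div_ne_zero hc (pow_ne_zero 2 ha))
  -- The Klein quartic in the coordinates `x, y, z`.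
  have hconic : x * y - x * z + y * z = 0 := by
    rw [hx, hy, hz]
    field_simp
    linear_combination (-K ^ 2) * hk
  have hP : q ^ 2 * (e' ^ 7 / e) = x * y * z := by
    rw [h₂, hx, hy, hz]
    field_simp
  have hT : e ^ 4 / (q * e' ^ 4) = (z ^ 2 - x * z - y ^ 2 - 6 * y * z) / (y * z) := by
    rw [h₁, ht, hx, hy, hz]
    field_simp
    linear_combination -(a ^ 3 * c ^ 2 + a ^ 2 * b ^ 3) * hk
  have hT' : e ^ 4 / (q * e' ^ 4) * (y * z) = z ^ 2 - x * z - y ^ 2 - 6 * y * z := by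
    rw [hT, div_mul_cancel₀ _ (mul_ne_zero hy0 hz0)]
  -- The left side is the product of those of the first two identities.
  have h₃ : q * e ^ 3 * e' ^ 3 = x * (z ^ 2 - y ^ 2 + 6 * x * y - 7 * x * z) := by
    have h : q * e ^ 3 * e' ^ 3 = e ^ 4 / (q * e' ^ 4) * (q ^ 2 * (e' ^ 7 / e)) := by
      field_simp
    rw [h, hP]
    linear_combination x * hT' - 6 * x * hconic
  refine ⟨hT, hP, h₃, ?_⟩
  -- The fourth left side is the product of the first and third.
  have h : e ^ 7 / e' = e ^ 4 / (q * e' ^ 4) * (q * e ^ 3 * e' ^ 3) := by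
    field_simp
  refine mul_left_cancel₀ (mul_ne_zero hy0 hz0) ?_
  rw [h, h₃]
  linear_combination x * (z ^ 2 - y ^ 2 + 6 * x * y - 7 * x * z) * hT' +
    (-7 * x ^ 2 * z - 6 * x * y ^ 2 - 2 * x * y * z + 8 * x * z ^ 2 + y ^ 3 - z ^ 3) * hconic

end Algebra

/-! ### Specialisation to the septic theta functions. -/

theorem im_pos_of_norm_nome_lt_one {τ : ℂ} (h : ‖nome τ‖ < 1) : 0 < τ.im := by
  have h1 : (2 * Real.pi * I * τ).re = -(2 * Real.pi * τ.im) := by simp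
  rw [nome, Complex.norm_exp, Real.exp_lt_one_iff, h1, neg_lt_zero] at h
  exact pos_of_mul_pos_right h Real.two_pi_pos.le

theorem thetaSeries_eq_thetaChar (k : ℤ) (τ : ℂ) :
    thetaSeries k τ = thetaChar (-1) (7 * τ) (k / 14) := by
  rw [thetaSeries, thetaChar]
  refine tsum_congr fun n => ?_
  rw [thetaCharTerm, qPow]
  push_cast
  congr 2
  ring

theorem thetaChar_one_sub {ε : ℂ} (hε : ε * ε = 1) (σ r : ℂ) :
    thetaChar ε σ (1 - r) = ε * thetaChar ε σ r := by
  rw [sub_eq_neg_add, thetaChar_add_one hε, thetaChar_neg hε]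

theorem cexp_eq_nome_pow {τ s : ℂ} (n : ℕ) (h : s = n * (2 * Real.pi * I * τ)) :
    cexp s = nome τ ^ n := by
  rw [h, Complex.exp_nat_mul, nome]

theorem thetaSeries_eq_qPochInf {τ : ℂ} (hτ : 0 < τ.im) {k : ℤ} {m n : ℕ} (hm : 2 * (m : ℤ) = 7 + k)
    (hn : 2 * (n : ℤ) = 7 - k) :
    thetaSeries k τ = qPow τ ((k : ℚ) ^ 2 / 56) * (qPochInf (nome τ ^ m) (nome τ ^ 7) *
      qPochInf (nome τ ^ n) (nome τ ^ 7) * qPochInf (nome τ ^ 7) (nome τ ^ 7)) := by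
  have hm' : 2 * (m : ℂ) = 7 + k := by exact_mod_cast congrArg (Int.cast : ℤ → ℂ) hm
  have hn' : 2 * (n : ℂ) = 7 - k := by exact_mod_cast congrArg (Int.cast : ℤ → ℂ) hn
  rw [thetaSeries_eq_thetaChar, thetaChar_eq_qPochInf (by norm_num) (im_ofNat_mul_pos hτ 7),
    neg_one_mul, neg_one_mul, neg_neg, neg_neg,
    cexp_eq_nome_pow (τ := τ) (s := 2 * Real.pi * I * (7 * τ)) 7 (by push_cast; ring),
    cexp_eq_nome_pow (τ := τ) (s := Real.pi * I * (7 * τ) * (1 + 2 * (k / 14))) m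
      (by linear_combination (-Real.pi * I * τ) * hm'),
    cexp_eq_nome_pow (τ := τ) (s := Real.pi * I * (7 * τ) * (1 - 2 * (k / 14))) n
      (by linear_combination (-Real.pi * I * τ) * hn'), qPow]
  congr 2
  push_cast
  ring

theorem norm_nome_pow_lt_one {τ : ℂ} (h : ‖nome τ‖ < 1) {n : ℕ} (hn : n ≠ 0) :
    ‖nome τ ^ n‖ < 1 := by
  rw [norm_pow]
  exact pow_lt_one₀ (norm_nonneg _) h hn

theorem qPow_add (τ : ℂ) (r s : ℚ) : qPow τ (r + s) = qPow τ r * qPow τ s := by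
  rw [qPow, qPow, qPow, ← Complex.exp_add]
  push_cast
  congr 1
  ring

theorem qPow_pow (τ : ℂ) (r : ℚ) (n : ℕ) : qPow τ r ^ n = qPow τ (n * r) := by
  rw [qPow, qPow, ← Complex.exp_nat_mul]
  push_cast
  congr 1
  ring

theorem qPow_natCast (τ : ℂ) (n : ℕ) : qPow τ n = nome τ ^ n := by
  rw [qPow]
  exact cexp_eq_nome_pow n (by push_cast; ring)

/-- The product of the three septic theta functions. -/
theorem thetaA_mul_thetaB_mul_thetaC {τ : ℂ} (h : ‖nome τ‖ < 1) :
    thetaA τ * thetaB τ * thetaC τ = -(qPow τ (5 / 8) * qPochInf (nome τ) (nome τ) *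
      qPochInf (nome τ ^ 7) (nome τ ^ 7) ^ 2) := by
  have hτ := im_pos_of_norm_nome_lt_one h
  have hprod := qPochInf_eq_prod (nome τ) h (m := 7) (by norm_num)
  simp only [Finset.prod_range_succ, Finset.prod_range_zero, one_mul, ← pow_succ',
    zero_add, pow_one, Nat.reduceAdd] at hprod
  -- `(25 + 9 + 1) / 56 = 5/8`. The three triple products cover the residues `{6, 1}, {5, 2}, {4,
  -- 3}` modulo 7.
  have hq : qPow τ (5 / 8) = qPow τ (5 ^ 2 / 56) * qPow τ (3 ^ 2 / 56) * qPow τ (1 ^ 2 / 56) := by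
    rw [← qPow_add, ← qPow_add]
    norm_num
  rw [thetaA, thetaB, thetaC, thetaSeries_eq_qPochInf hτ (k := 5) (m := 6) (n := 1) rfl rfl,
    thetaSeries_eq_qPochInf hτ (k := 3) (m := 5) (n := 2) rfl rfl,
    thetaSeries_eq_qPochInf hτ (k := 1) (m := 4) (n := 3) rfl rfl, hprod, hq]
  push_cast
  rw [pow_one (nome τ)]
  ring

/-- The product of the three even Jacobi theta constants. -/
theorem thetaChar_constants_mul {σ : ℂ} (hσ : 0 < σ.im) (h : ‖nome σ‖ < 1) :
    thetaChar 1 σ (1 / 2) * thetaChar 1 σ 0 * thetaChar (-1) σ 0 =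
      2 * (cexp (Real.pi * I * σ / 4) * qPochInf (nome σ) (nome σ) ^ 3) := by
  have e1 : cexp (Real.pi * I * σ * (1 + 2 * (1 / 2))) = nome σ := by
    rw [nome]; congr 1; ring
  have e2 : cexp (Real.pi * I * σ * (1 - 2 * (1 / 2))) = 1 := by
    rw [← Complex.exp_zero]; congr 1; ring
  have e3 : cexp (Real.pi * I * σ * (1 / 2) ^ 2) = cexp (Real.pi * I * σ / 4) := by
    congr 1; ring
  have e4 : cexp (Real.pi * I * σ) ^ 2 = nome σ := by
    rw [← Complex.exp_nat_mul, nome]; push_cast; congr 1; ring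
  have h1 := qPochInf_mul_qPochInf_neg (cexp (Real.pi * I * σ)) h
  rw [e4] at h1
  have h2 := qPochInf_neg_mul_qPochInf_sq h
  have h3 := qPochInf_eq_one_sub_mul (-1) h
  rw [neg_one_mul] at h3
  rw [thetaChar_eq_qPochInf (one_mul 1) hσ, thetaChar_eq_qPochInf (one_mul 1) hσ,
    thetaChar_eq_qPochInf (ε := -1) (by norm_num) hσ, e1, e2, e3]
  simp only [mul_zero, add_zero, sub_zero, mul_one, one_mul, neg_mul, neg_neg, ne_eq,
    OfNat.ofNat_ne_zero, not_false_eq_true, zero_pow, Complex.exp_zero]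
  rw [← nome, h3]
  set P := qPochInf (nome σ) (nome σ)
  set N := qPochInf (-nome σ) (nome σ)
  set W := qPochInf (nome σ) (nome σ ^ 2)
  set U := qPochInf (cexp (Real.pi * I * σ)) (nome σ)
  set V := qPochInf (-cexp (Real.pi * I * σ)) (nome σ)
  set E := cexp (Real.pi * I * σ / 4)
  -- The product of constants is `2 E P³ (N U V)²`, the 2 being `1 - (-1)` from `(-1; p)_∞`.
  have h4 : N * (U * V) = 1 := by rw [h1, h2]
  linear_combination 2 * E * P ^ 3 * (N * (U * V) + 1) * h4

/-- The Klein quartic and the relation between the septic theta functions and the theta constants of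
order two. -/
theorem septic_relations {τ : ℂ} (hτ : 0 < τ.im) (ha : thetaA τ ≠ 0) (hb : thetaB τ ≠ 0)
    (hc : thetaC τ ≠ 0) {K : ℂ} (hK : K ≠ 0)
    (h : thetaChar 1 (7 * τ) (1 / 2) * thetaChar 1 (7 * τ) 0 * thetaChar (-1) (7 * τ) 0 = 2 * K) :
    thetaA τ ^ 3 * thetaB τ + thetaB τ ^ 3 * thetaC τ + thetaC τ ^ 3 * thetaA τ = 0 ∧
      (thetaA τ * thetaB τ * thetaC τ) ^ 4 = -K ^ 4 *
        (thetaB τ ^ 2 * thetaC τ / thetaA τ ^ 3 + thetaC τ ^ 2 * thetaA τ / thetaB τ ^ 3 +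
          thetaA τ ^ 2 * thetaB τ / thetaC τ ^ 3 + 8) := by
  have hε : (-1 : ℂ) * -1 = 1 := by norm_num
  have hσ : 0 < (7 * τ).im := im_ofNat_mul_pos hτ 7
  have hA : thetaA τ = -thetaChar (-1) (7 * τ) (5 / 14) := by
    rw [thetaA, thetaSeries_eq_thetaChar]; norm_num
  have hB : thetaB τ = thetaChar (-1) (7 * τ) (3 / 14) := by
    rw [thetaB, thetaSeries_eq_thetaChar]; norm_num
  have hC : thetaC τ = thetaChar (-1) (7 * τ) (1 / 14) := by
    rw [thetaC, thetaSeries_eq_thetaChar]; norm_num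
  have s₁ : thetaChar (-1) (7 * τ) (1 / 7 + 1 / 2) = thetaA τ := by
    rw [hA, ← neg_one_mul (thetaChar _ _ _), ← thetaChar_one_sub hε]; norm_num
  have s₂ : thetaChar (-1) (7 * τ) (2 / 7 + 1 / 2) = -thetaB τ := by
    rw [hB, ← neg_one_mul (thetaChar _ _ _), ← thetaChar_one_sub hε]; norm_num
  have s₃ : thetaChar (-1) (7 * τ) (3 / 7 + 1 / 2) = -thetaC τ := by
    rw [hC, ← neg_one_mul (thetaChar _ _ _), ← thetaChar_one_sub hε]; norm_num
  have s₄ : thetaChar (-1) (7 * τ) (4 / 7 + 1 / 2) = -thetaC τ := by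
    rw [hC, ← neg_one_mul (thetaChar _ _ _), ← thetaChar_add_one hε]; norm_num
  have s₅ : thetaChar (-1) (7 * τ) (5 / 7 + 1 / 2) = -thetaB τ := by
    rw [hB, ← neg_one_mul (thetaChar _ _ _), ← thetaChar_add_one hε]; norm_num
  have s₆ : thetaChar (-1) (7 * τ) (6 / 7 + 1 / 2) = thetaA τ := by
    rw [hA, ← neg_one_mul (thetaChar _ _ _), ← thetaChar_add_one hε]; norm_num
  generalize thetaA τ = a at *
  generalize thetaB τ = b at *
  generalize thetaC τ = c at *
  -- The shift of `u` by `1/2` in the addition formula produces the determinant; `v = 0` or `ε = 1`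
  -- gives the squares below.
  have hbr (u v : ℂ) : thetaChar 1 (2 * (7 * τ)) (u + 1 / 2) * thetaChar 1 (2 * (7 * τ)) v -
      thetaChar 1 (2 * (7 * τ)) u * thetaChar 1 (2 * (7 * τ)) (v + 1 / 2) =
      thetaChar (-1) (7 * τ) (u + v + 1 / 2) * thetaChar (-1) (7 * τ) (u - v + 1 / 2) := by
    have h1 := thetaChar_add_mul_thetaChar_sub hε hσ (u + 1 / 2) v
    rw [add_assoc u (1 / 2) (1 / 2), add_halves, thetaChar_add_one (one_mul 1), one_mul] at h1
    rw [add_right_comm u v, show u - v + 1 / 2 = u + 1 / 2 - v by ring, h1]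
    ring
  have hsq₁ (u : ℂ) : thetaChar (-1) (7 * τ) (u + 1 / 2) ^ 2 =
      thetaChar 1 (2 * (7 * τ)) (u + 1 / 2) * thetaChar 1 (2 * (7 * τ)) 0 -
      thetaChar 1 (2 * (7 * τ)) u * thetaChar 1 (2 * (7 * τ)) (1 / 2) := by
    have h1 := hbr u 0
    rw [add_zero, sub_zero, zero_add] at h1
    rw [h1, pow_two]
  have hsq₂ (u : ℂ) : thetaChar 1 (7 * τ) (u + 1 / 2) ^ 2 =
      thetaChar 1 (2 * (7 * τ)) (u + 1 / 2) * thetaChar 1 (2 * (7 * τ)) 0 +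
      thetaChar 1 (2 * (7 * τ)) u * thetaChar 1 (2 * (7 * τ)) (1 / 2) := by
    have h1 := thetaChar_add_mul_thetaChar_sub (one_mul 1) hσ (u + 1 / 2) 0
    rw [add_zero, sub_zero, add_assoc u (1 / 2) (1 / 2), add_halves,
      thetaChar_add_one (one_mul 1), one_mul, zero_add, one_mul] at h1
    rw [← h1, pow_two]
  have hsq₃ {ε : ℂ} (hε : ε * ε = 1) (u : ℂ) : thetaChar ε (7 * τ) u ^ 2 =
      thetaChar 1 (2 * (7 * τ)) u * thetaChar 1 (2 * (7 * τ)) 0 +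
      ε * (thetaChar 1 (2 * (7 * τ)) (u + 1 / 2) * thetaChar 1 (2 * (7 * τ)) (1 / 2)) := by
    have h1 := thetaChar_add_mul_thetaChar_sub hε hσ u 0
    rw [add_zero, sub_zero, zero_add] at h1
    rw [← h1, pow_two]
  -- The squared duplication formula, with the squares of the three even functions written as linear
  -- forms.
  have hdup (u : ℂ) : thetaChar (-1) (7 * τ) (u + 1 / 2) ^ 2 *
      ((thetaChar 1 (2 * (7 * τ)) (u + 1 / 2) * thetaChar 1 (2 * (7 * τ)) 0 +
        thetaChar 1 (2 * (7 * τ)) u * thetaChar 1 (2 * (7 * τ)) (1 / 2)) *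
      (thetaChar 1 (2 * (7 * τ)) u * thetaChar 1 (2 * (7 * τ)) 0 -
        thetaChar 1 (2 * (7 * τ)) (u + 1 / 2) * thetaChar 1 (2 * (7 * τ)) (1 / 2)) *
      (thetaChar 1 (2 * (7 * τ)) u * thetaChar 1 (2 * (7 * τ)) 0 +
        thetaChar 1 (2 * (7 * τ)) (u + 1 / 2) * thetaChar 1 (2 * (7 * τ)) (1 / 2))) =
      K ^ 2 * thetaChar (-1) (7 * τ) (2 * u + 1 / 2) ^ 2 := by
    have h1 := thetaChar_duplication hσ u
    rw [h, mul_assoc 2] at h1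
    have h2 := mul_left_cancel₀ two_ne_zero h1
    have h3 := hsq₃ hε u
    have h4 := hsq₃ (one_mul 1) u
    rw [neg_one_mul, ← sub_eq_add_neg] at h3
    rw [one_mul] at h4
    rw [← hsq₂, ← h3, ← h4, ← mul_pow K, ← h2]
    ring
  have h₀ : 2 * thetaChar 1 (2 * (7 * τ)) 0 * thetaChar 1 (2 * (7 * τ)) (1 / 2) *
      (thetaChar 1 (2 * (7 * τ)) 0 ^ 2 - thetaChar 1 (2 * (7 * τ)) (1 / 2) ^ 2) *
      (thetaChar 1 (2 * (7 * τ)) 0 ^ 2 + thetaChar 1 (2 * (7 * τ)) (1 / 2) ^ 2) = 4 * K ^ 2 := by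
    have h1 := hsq₂ 0
    have h2 := hsq₃ hε 0
    have h3 := hsq₃ (one_mul 1) 0
    rw [zero_add] at h1 h2 h3
    rw [show 4 * K ^ 2 = (2 * K) ^ 2 by ring, ← h, mul_pow, mul_pow, h1, h2, h3]
    ring
  have t₁ := hdup (1 / 7)
  have t₂ := hdup (2 / 7)
  have t₃ := hdup (3 / 7)
  rw [show (2 * (1 / 7) : ℂ) = 2 / 7 by norm_num, s₁, s₂, neg_sq] at t₁
  rw [show (2 * (2 / 7) : ℂ) = 4 / 7 by norm_num, s₂, s₄, neg_sq, neg_sq] at t₂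
  rw [show (2 * (3 / 7) : ℂ) = 6 / 7 by norm_num, s₃, s₆, neg_sq] at t₃
  refine septic_relations_of_brackets ha hb hc hK
    (by rw [← hsq₁, s₁]) (by rw [← hsq₁, s₂, neg_sq]) (by rw [← hsq₁, s₃, neg_sq])
    ?_ ?_ ?_ h₀ t₁ t₂ t₃
  · rw [hbr, show (2 / 7 + 1 / 7 : ℂ) = 3 / 7 by norm_num, s₃,
      show (2 / 7 - 1 / 7 : ℂ) = 1 / 7 by norm_num, s₁, neg_mul]
  · rw [hbr, show (3 / 7 + 1 / 7 : ℂ) = 4 / 7 by norm_num, s₄,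
      show (3 / 7 - 1 / 7 : ℂ) = 2 / 7 by norm_num, s₂, neg_mul_neg, mul_comm]
  · rw [hbr, show (3 / 7 + 2 / 7 : ℂ) = 5 / 7 by norm_num, s₅,
      show (3 / 7 - 2 / 7 : ℂ) = 1 / 7 by norm_num, s₁, neg_mul, mul_comm]

end Septic

/-! ### Assembly. -/

theorem mainTheorem7 (q τ : ℂ) (hq : ‖q‖ < 1) (hτ : q = Septic.nome τ)
    (x y z : ℂ) (hx : x = Septic.x τ) (hy : y = Septic.y τ) (hz : z = Septic.z τ) :
    -- every denominator that occurs is nonzero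
    (Septic.thetaA τ ≠ 0 ∧ Septic.thetaB τ ≠ 0 ∧ Septic.thetaC τ ≠ 0 ∧
      Septic.qPochInf q q ≠ 0 ∧ Septic.qPochInf (q ^ 7) (q ^ 7) ≠ 0 ∧ y ≠ 0 ∧ z ≠ 0) ∧
    -- the four identities
    Septic.qPochInf q q ^ 4 / (q * Septic.qPochInf (q ^ 7) (q ^ 7) ^ 4) =
      (z ^ 2 - x * z - y ^ 2 - 6 * y * z) / (y * z) ∧
    q ^ 2 * (Septic.qPochInf (q ^ 7) (q ^ 7) ^ 7 / Septic.qPochInf q q) = x * y * z ∧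
    q * Septic.qPochInf q q ^ 3 * Septic.qPochInf (q ^ 7) (q ^ 7) ^ 3 =
      x * (z ^ 2 - y ^ 2 + 6 * x * y - 7 * x * z) ∧
    Septic.qPochInf q q ^ 7 / Septic.qPochInf (q ^ 7) (q ^ 7) =
      x ^ 3 - 32 * x ^ 2 * y + 13 * x * y ^ 2 - y ^ 3 + 45 * x ^ 2 * z - 13 * x * z ^ 2
        + z ^ 3 := by
  subst hτ
  have him := Septic.im_pos_of_norm_nome_lt_one hq
  have hq0 : Septic.nome τ ≠ 0 := Complex.exp_ne_zero _
  have hq7 := Septic.norm_nome_pow_lt_one hq (n := 7) (by norm_num)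
  have he := Septic.qPochInf_self_ne_zero hq
  have he' := Septic.qPochInf_self_ne_zero hq7
  have hr : Septic.qPow τ (7 / 8) ≠ 0 := Complex.exp_ne_zero _
  have hs : Septic.qPow τ (5 / 8) ≠ 0 := Complex.exp_ne_zero _
  have habc := Septic.thetaA_mul_thetaB_mul_thetaC hq
  have hne : Septic.thetaA τ * Septic.thetaB τ * Septic.thetaC τ ≠ 0 := by
    rw [habc]
    exact neg_ne_zero.2 (mul_ne_zero (mul_ne_zero hs he) (pow_ne_zero 2 he'))
  have ha := left_ne_zero_of_mul (left_ne_zero_of_mul hne)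
  have hb := right_ne_zero_of_mul (left_ne_zero_of_mul hne)
  have hc := right_ne_zero_of_mul hne
  have hnome : Septic.nome (7 * τ) = Septic.nome τ ^ 7 :=
    Septic.cexp_eq_nome_pow 7 (by push_cast; ring)
  have hK := mul_ne_zero hr (pow_ne_zero 3 he')
  have hconst := Septic.thetaChar_constants_mul (Septic.im_ofNat_mul_pos him 7)
    (by rw [hnome]; exact hq7)
  rw [hnome, show cexp (Real.pi * I * (7 * τ) / 4) = Septic.qPow τ (7 / 8) by
    rw [Septic.qPow]; push_cast; congr 1; ring] at hconst
  obtain ⟨hk, ht⟩ := Septic.septic_relations him ha hb hc hK hconst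
  -- Exponents: `4 · 7/8 = 4 · 5/8 + 1`, and below `3 · 7/8 = 5/8 + 2`.
  have hrs : Septic.qPow τ (7 / 8) ^ 4 = Septic.qPow τ (5 / 8) ^ 4 * Septic.nome τ := by
    rw [Septic.qPow_pow, Septic.qPow_pow, ← pow_one (Septic.nome τ), ← Septic.qPow_natCast,
      ← Septic.qPow_add]
    norm_num
  have hrs' : Septic.qPow τ (7 / 8) ^ 3 = Septic.qPow τ (5 / 8) * Septic.nome τ ^ 2 := by
    rw [Septic.qPow_pow, ← Septic.qPow_natCast, ← Septic.qPow_add]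
    norm_num
  have hy' : y = -(Septic.qPow τ (7 / 8) * Septic.qPochInf (Septic.nome τ ^ 7)
      (Septic.nome τ ^ 7) ^ 3) * (Septic.thetaA τ / Septic.thetaB τ ^ 2) := by
    rw [hy, Septic.y, neg_mul]
  refine ⟨⟨ha, hb, hc, he, he', ?_, ?_⟩,
    Septic.septic_identities ha hb hc hK hq0 he he' hk ht ?_ ?_ hx hy' hz⟩
  · rw [hy']
    exact mul_ne_zero (neg_ne_zero.2 hK) (div_ne_zero ha (pow_ne_zero 2 hb))
  · rw [hz]
    exact mul_ne_zero hK (div_ne_zero hc (pow_ne_zero 2 ha))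
  · rw [habc, mul_pow, hrs]
    field_simp
  · rw [habc, mul_pow, hrs']
    field_simp
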